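/- Let $q(m,n)=am^2+bmn+cn^2$ be a binary quadratic form with integer coefficients, $\gcd(a,b,c)=1$, whose discriminant $D=b^2-4ac$ is positive and not a perfect square. Let $\varepsilon_D=(t_D+u_D\sqrt D)/2$, where $(t_D,u_D)$ is the smallest solution of $t^2-Du^2=4$ in positive integers. Let $\mathcal T$ be the topograph of $q$. Its vertices are the superbases $\{v_1,v_2,v_3\}$ of $\mathbb Z^2$ (that is, $v_1+v_2+v_3=0$ and $v_1,v_2$ form a basis of $\mathbb Z^2$) up to a common sign. Its edges are the sets $\{\pm v_1,\pm v_2\}$ where $v_1,v_2$ is a basis of $\mathbb Z^2$, and the edges at the vertex $\{v_1,v_2,v_3\}$ are $\{\pm v_1,\pm v_2\}$, $\{\pm v_1,\pm v_3\}$, $\{\pm v_2,\pm v_3\}$. The edge $\{\pm v_1,\pm v_2\}$ separates the regions $\pm v_1$ and $\pm v_2$, the label of the region $\pm v$ is $q(v)$, and the label $e$ of the edge $\{\pm v_1,\pm v_2\}$ (defined up to sign) has absolute value $|e|=|q(v_1+v_2)-q(v_1)-q(v_2)|$. The river consists of the edges that separate regions with labels of opposite signs; a river vertex is an endpoint of such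 an edge. Let $\Gamma$ be the group of all $g\in SL(2,\mathbb Z)$ with $q(gv)=q(v)$ for all $v\in\mathbb Z^2$; it acts on $\mathcal T$ by the label-preserving translations along the river, and "modulo the river period" means modulo the action of $\Gamma$. Let $\mathcal B$ be the set of edges that are incident to a river vertex but do not lie on the river. Then $\mathcal B/\Gamma$ is finite, the label $e$ of every edge in $\mathcal B$ satisfies $|e|>\sqrt D$, and $$2\log\varepsilon_D=\sum_{E\in\mathcal B/\Gamma}\operatorname{arctanh}\frac{\sqrt D}{|e|},$$ where $e$ is the label of the edge $E$. -/

import Mathlib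

open scoped Matrix MatrixGroups

/-- A binary quadratic form `[a, b, c]`, that is `q(m, n) = a m² + b m n + c n²`. -/
structure BinaryForm where
  a : ℤ
  b : ℤ
  c : ℤ

namespace BinaryForm

/-- The value `q(v)` for `v = (m, n)`. -/
def eval (q : BinaryForm) (v : Fin 2 → ℤ) : ℤ :=
  q.a * v 0 ^ 2 + q.b * (v 0 * v 1) + q.c * v 1 ^ 2

/-- The discriminant `b² - 4ac`. -/
def disc (q : BinaryForm) : ℤ := q.b ^ 2 - 4 * q.a * q.c

/-- The form is primitive: `gcd(a, b, c) = 1`. -/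
def IsPrimitive (q : BinaryForm) : Prop := Int.gcd q.a (Int.gcd q.b q.c) = 1

/-- `q(v + w) - q(v) - q(w) = 2B(v, w)`, where `B` is the symmetric bilinear form of `q`. -/
def polar (q : BinaryForm) (v w : Fin 2 → ℤ) : ℤ :=
  q.eval (v + w) - q.eval v - q.eval w

theorem eval_neg (q : BinaryForm) (v : Fin 2 → ℤ) : q.eval (-v) = q.eval v := by
  simp [eval]

theorem polar_comm (q : BinaryForm) (v w : Fin 2 → ℤ) : q.polar v w = q.polar w v := by
  simp only [polar, eval, Pi.add_apply]; ring

theorem polar_neg_left (q : BinaryForm) (v w : Fin 2 → ℤ) : q.polar (-v) w = -q.polar v w := by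
  simp only [polar, eval, Pi.add_apply, Pi.neg_apply]; ring

theorem polar_neg_right (q : BinaryForm) (v w : Fin 2 → ℤ) :
    q.polar v (-w) = -q.polar v w := by
  simp only [polar, eval, Pi.add_apply, Pi.neg_apply]; ring

end BinaryForm

namespace Topograph

/-- `v, w` form a basis of `ℤ²` (the determinant is `±1`). -/
def IsBasis (v w : Fin 2 → ℤ) : Prop := IsUnit (v 0 * w 1 - v 1 * w 0)

/-- A vertex of the topograph: a superbase `v₁ + v₂ + v₃ = 0` up to a common sign, given as the
set `{±v₁, ±v₂, ±v₃}` (this set determines the superbase up to a common sign).  The three regions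
around the vertex are `±v₁`, `±v₂`, `±v₃`. -/
structure Vertex where
  carrier : Set (Fin 2 → ℤ)
  isSuperbase : ∃ v₁ v₂ v₃ : Fin 2 → ℤ, v₁ + v₂ + v₃ = 0 ∧ IsBasis v₁ v₂ ∧
    carrier = {v₁, -v₁, v₂, -v₂, v₃, -v₃}

/-- An edge of the topograph: the set `{±v₁, ±v₂}` for a basis `v₁, v₂` of `ℤ²`.  It separates
the regions `±v₁` and `±v₂`, and it joins the vertices `{±v₁, ±v₂, ±(v₁ + v₂)}` and
`{±v₁, ±v₂, ±(v₁ - v₂)}`. -/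
structure Edge where
  carrier : Set (Fin 2 → ℤ)
  isBasis : ∃ v₁ v₂ : Fin 2 → ℤ, IsBasis v₁ v₂ ∧ carrier = {v₁, -v₁, v₂, -v₂}

/-- The edge `E` ends at the vertex `V`: the edges at `{±v₁, ±v₂, ±v₃}` are
`{±v₁, ±v₂}`, `{±v₁, ±v₃}` and `{±v₂, ±v₃}`. -/
def Incident (E : Edge) (V : Vertex) : Prop := E.carrier ⊆ V.carrier

/-- The river consists of the edges that separate two regions with labels of opposite signs
(the label of the region `±v` is `q(v)`). -/
def IsRiverEdge (q : BinaryForm) (E : Edge) : Prop :=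
  ∃ v ∈ E.carrier, ∃ w ∈ E.carrier, q.eval v < 0 ∧ 0 < q.eval w

/-- A vertex on the river. -/
def IsRiverVertex (q : BinaryForm) (V : Vertex) : Prop :=
  ∃ E : Edge, IsRiverEdge q E ∧ Incident E V

/-- The edges adjacent to the vertices of the river, but not lying in the river. -/
def BankEdge (q : BinaryForm) : Type :=
  {E : Edge // ¬ IsRiverEdge q E ∧ ∃ V : Vertex, IsRiverVertex q V ∧ Incident E V}

/-- The absolute value `|e|` of the label on an edge.  If `E = {±v₁, ±v₂}`, then
`|e| = |q(v₁ + v₂) - q(v₁) - q(v₂)|`; see `absLabel_eq` for the independence of choices. -/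
noncomputable def absLabel (q : BinaryForm) (E : Edge) : ℤ :=
  |q.polar E.isBasis.choose E.isBasis.choose_spec.choose|

theorem abs_polar_eq (q : BinaryForm) {v w v' w' : Fin 2 → ℤ} (h' : IsBasis v' w')
    (hv : v' ∈ ({v, -v, w, -w} : Set (Fin 2 → ℤ)))
    (hw : w' ∈ ({v, -v, w, -w} : Set (Fin 2 → ℤ))) :
    |q.polar v' w'| = |q.polar v w| := by
  have hself : ∀ x : Fin 2 → ℤ, ¬ IsBasis x x := by
    intro x hx
    have h0 : x 0 * x 1 - x 1 * x 0 = 0 := by ring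
    simp [IsBasis, h0] at hx
  have hneg : ∀ x : Fin 2 → ℤ, ¬ IsBasis x (-x) := by
    intro x hx
    have h0 : x 0 * (-x) 1 - x 1 * (-x) 0 = 0 := by simp only [Pi.neg_apply]; ring
    rw [IsBasis, h0] at hx
    simp at hx
  have hneg' : ∀ x : Fin 2 → ℤ, ¬ IsBasis (-x) x := fun x hx =>
    hneg (-x) (by rwa [neg_neg])
  simp only [Set.mem_insert_iff, Set.mem_singleton_iff] at hv hw
  rcases hv with rfl | rfl | rfl | rfl <;> rcases hw with hw | hw | hw | hw <;> subst hw <;>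
    first
    | exact absurd h' (hself _)
    | exact absurd h' (hneg _)
    | exact absurd h' (hneg' _)
    | (simp only [q.polar_neg_left, q.polar_neg_right, abs_neg]; done)
    | exact congrArg abs (q.polar_comm _ _)
    | (simp only [q.polar_neg_left, q.polar_neg_right, abs_neg]
       exact congrArg abs (q.polar_comm _ _))

theorem absLabel_eq (q : BinaryForm) (E : Edge) {v w : Fin 2 → ℤ}
    (hE : E.carrier = {v, -v, w, -w}) : absLabel q E = |q.polar v w| := by
  obtain ⟨hb, hc⟩ := E.isBasis.choose_spec.choose_spec
  exact abs_polar_eq q hb ((hc.symm.trans hE).subset (by simp))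
    ((hc.symm.trans hE).subset (by simp))

/-- The river period, as a group of translations.  The orientation preserving symmetries of the
planar tree are the elements of `SL(2, ℤ)` (modulo `±1`), acting on `ℤ²`.  The ones that keep the
labels of all regions are the translations along the river by the multiples of its period. -/
def periodGroup (q : BinaryForm) : Subgroup SL(2, ℤ) where
  carrier := {g | ∀ v : Fin 2 → ℤ, q.eval (g.1 *ᵥ v) = q.eval v}
  mul_mem' := by
    intro g h hg hh v
    rw [Matrix.SpecialLinearGroup.coe_mul, ← Matrix.mulVec_mulVec, hg, hh]
  one_mem' := by intro v; simp
  inv_mem' := by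
    intro g hg v
    rw [← hg ((g⁻¹).1 *ᵥ v), Matrix.mulVec_mulVec, ← Matrix.SpecialLinearGroup.coe_mul]
    simp

/-- Two edges are identified modulo the river period if one is a translate of the other. -/
def bankSetoid (q : BinaryForm) : Setoid (BankEdge q) where
  r E E' := ∃ g ∈ periodGroup q, E'.1.carrier = (fun v => g.1 *ᵥ v) '' E.1.carrier
  iseqv :=
    { refl := fun E => ⟨1, one_mem _, by simp⟩
      symm := by
        rintro E E' ⟨g, hg, h⟩
        refine ⟨g⁻¹, inv_mem hg, ?_⟩
        rw [h, Set.image_image]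
        simp only [Matrix.mulVec_mulVec, ← Matrix.SpecialLinearGroup.coe_mul, inv_mul_cancel,
          Matrix.SpecialLinearGroup.coe_one, Matrix.one_mulVec, Set.image_id']
      trans := by
        rintro E E' E'' ⟨g, hg, h⟩ ⟨k, hk, h'⟩
        refine ⟨k * g, mul_mem hk hg, ?_⟩
        rw [h', h, Set.image_image]
        simp only [Matrix.mulVec_mulVec, Matrix.SpecialLinearGroup.coe_mul] }

theorem absLabel_congr (q : BinaryForm) {E E' : BankEdge q} (h : (bankSetoid q).r E E') :
    absLabel q E.1 = absLabel q E'.1 := by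
  obtain ⟨g, hg, h⟩ := h
  obtain ⟨v, w, -, hE⟩ := E.1.isBasis
  have hE' : E'.1.carrier = {g.1 *ᵥ v, -(g.1 *ᵥ v), g.1 *ᵥ w, -(g.1 *ᵥ w)} := by
    rw [h, hE]
    simp only [Set.image_insert_eq, Set.image_singleton, Matrix.mulVec_neg]
  have hg' : ∀ v : Fin 2 → ℤ, q.eval (g.1 *ᵥ v) = q.eval v := hg
  rw [absLabel_eq q E.1 hE, absLabel_eq q E'.1 hE', BinaryForm.polar, BinaryForm.polar,
    ← Matrix.mulVec_add, hg', hg', hg']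

/-- The edges adjacent to the vertices of the river, but not lying in the river, modulo the
river period. -/
abbrev BankEdgeModPeriod (q : BinaryForm) : Type := Quotient (bankSetoid q)

/-- The absolute value of the label of an edge modulo the river period. -/
noncomputable def absLabelModPeriod (q : BinaryForm) (x : BankEdgeModPeriod q) : ℤ :=
  Quotient.lift (fun E : BankEdge q => absLabel q E.1) (fun _ _ h => absLabel_congr q h) x

end Topograph

namespace FundamentalUnit

/-- `(t, u)` is a solution of `t² - D u² = 4` in positive integers. -/
def IsSolution (D : ℤ) (t u : ℕ) : Prop :=
  0 < t ∧ 0 < u ∧ (t : ℤ) ^ 2 - D * (u : ℤ) ^ 2 = 4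

/-- The smallest `t` in a positive solution of `t² - D u² = 4`. -/
noncomputable def tMin (D : ℤ) : ℕ := sInf {t | ∃ u, IsSolution D t u}

/-- The smallest `u` in a positive solution of `t² - D u² = 4`. -/
noncomputable def uMin (D : ℤ) : ℕ := sInf {u | ∃ t, IsSolution D t u}

/-- The two minima are attained together: `(t_D, u_D)` is the smallest positive solution. -/
theorem isSolution_min {D : ℤ} (hD : 0 < D) (hsq : ¬ IsSquare D) :
    IsSolution D (tMin D) (uMin D) := by
  have hne : ∃ t u, IsSolution D t u := by
    obtain ⟨x, hx, hy⟩ := Pell.Solution₁.exists_pos_of_not_isSquare hD hsq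
    refine ⟨(2 * x.x).toNat, (2 * x.y).toNat, by omega, by omega, ?_⟩
    have h1 : ((2 * x.x).toNat : ℤ) = 2 * x.x := Int.toNat_of_nonneg (by omega)
    have h2 : ((2 * x.y).toNat : ℤ) = 2 * x.y := Int.toNat_of_nonneg (by omega)
    rw [h1, h2]
    linear_combination 4 * x.prop
  obtain ⟨t₀, u₀, h₀⟩ := hne
  obtain ⟨u₁, ht⟩ : ∃ u, IsSolution D (tMin D) u :=
    Nat.sInf_mem (s := {t | ∃ u, IsSolution D t u}) ⟨t₀, u₀, h₀⟩
  obtain ⟨t₁, hu⟩ : ∃ t, IsSolution D t (uMin D) :=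
    Nat.sInf_mem (s := {u | ∃ t, IsSolution D t u}) ⟨u₀, t₀, h₀⟩
  have h1 : uMin D ≤ u₁ := Nat.sInf_le ⟨_, ht⟩
  have h2 : tMin D ≤ t₁ := Nat.sInf_le ⟨_, hu⟩
  have h3 : (uMin D : ℤ) ^ 2 ≤ (u₁ : ℤ) ^ 2 := by gcongr
  have h4 : (tMin D : ℤ) ^ 2 ≤ (t₁ : ℤ) ^ 2 := by gcongr
  refine ⟨ht.1, hu.2.1, ?_⟩
  have e1 := ht.2.2
  have e2 := hu.2.2
  nlinarith [mul_le_mul_of_nonneg_left h3 hD.le]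

/-- The fundamental unit `ε_D = (t_D + u_D √D) / 2`. -/
noncomputable def epsilon (D : ℤ) : ℝ := (tMin D + uMin D * √(D : ℝ)) / 2

end FundamentalUnit

/-! Over `ℝ` the form splits as `q = lam * mu`; put `φ(v) = log |lam v / mu v|`. For a basis `x, y`
of determinant 1, `polar x y` and `√D` are the sum and the difference of `mu x * lam y` and `lam x *
mu y`. On a bank edge these two products have the same sign. Hence `|e| > √D`, the quotient `(|e| +
√D) / (|e| - √D)` is a ratio of the products, and `arctanh (√D / |e|)` is half of `±(φ(y) - φ(x))`.

The river is followed as an orbit of `step` on pairs `(v, w)` with `q(v) > 0 > q(w)`. A step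
replaces `v` or `w` by `v + w`, and the bank edge at the vertex passed separates the replaced vector
from `v + w`. Its term is therefore half the increment of the potential `φ(v) + φ(w)`
(`sqrt_lt_and_artanh_eq`).

An element of `Γ` scales `lam` by some `η` and `mu` by `η⁻¹`, where `η` comes from a solution of `t²
- D u² = 4` (`exists_multiplier`; primitivity enters here); for `η > 0` it raises the potential by
`4 log η`. The first return of the river modulo `Γ` has `η = ε_D` (`exists_period`). Bank edges
modulo `Γ` correspond to the steps of one period (`exists_isRiverPair_of_bankEdge`,
`exists_eq_act_iterate`, `eq_of_edgeSet_eq`), so the sum telescopes to `2 log ε_D`. -/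

namespace BinaryForm

/-! ### Linear factors and determinants -/

/-- The determinant of a pair of vectors of `ℤ²`. -/
def det (v w : Fin 2 → ℤ) : ℤ := v 0 * w 1 - v 1 * w 0

/-- The first linear factor of the form over `ℝ`. -/
noncomputable def lam (q : BinaryForm) (v : Fin 2 → ℤ) : ℝ :=
  q.a * v 0 + (q.b + √(q.disc : ℝ)) / 2 * v 1

/-- The second linear factor of the form over `ℝ`, so that `q = lam * mu`. -/
noncomputable def mu (q : BinaryForm) (v : Fin 2 → ℤ) : ℝ :=
  v 0 + (q.b - √(q.disc : ℝ)) / (2 * q.a) * v 1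

theorem lam_add (q : BinaryForm) (v w : Fin 2 → ℤ) : q.lam (v + w) = q.lam v + q.lam w := by
  simp only [lam, Pi.add_apply]; push_cast; ring

theorem mu_add (q : BinaryForm) (v w : Fin 2 → ℤ) : q.mu (v + w) = q.mu v + q.mu w := by
  simp only [mu, Pi.add_apply]; push_cast; ring

theorem lam_neg (q : BinaryForm) (v : Fin 2 → ℤ) : q.lam (-v) = -q.lam v := by
  simp only [lam, Pi.neg_apply]; push_cast; ring

theorem mu_neg (q : BinaryForm) (v : Fin 2 → ℤ) : q.mu (-v) = -q.mu v := by
  simp only [mu, Pi.neg_apply]; push_cast; ring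

theorem a_ne_zero {q : BinaryForm} (hsq : ¬ IsSquare q.disc) : q.a ≠ 0 := by
  intro h
  exact hsq ⟨q.b, by simp [disc, h]; ring⟩

/-- By `4a q(m, n) = (2am + bn)² - D n²`, a nontrivial zero would make `D` a square. -/
theorem eval_ne_zero {q : BinaryForm} (hsq : ¬ IsSquare q.disc) {v : Fin 2 → ℤ} (hv : v ≠ 0) :
    q.eval v ≠ 0 := by
  intro h
  have key : (2 * q.a * v 0 + q.b * v 1) ^ 2 = q.disc * v 1 ^ 2 := by
    simp only [eval] at h
    simp only [disc]
    linear_combination 4 * q.a * h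
  have h1 : v 1 ≠ 0 := by
    intro h1
    have h0 : v 0 = 0 := by
      simp only [h1] at key
      have : 2 * q.a * v 0 = 0 := by
        have := key
        simpa using this
      simpa [a_ne_zero hsq] using this
    exact hv (by ext i; fin_cases i <;> simp [h0, h1])
  have hd : v 1 ∣ 2 * q.a * v 0 + q.b * v 1 :=
    (Int.pow_dvd_pow_iff two_ne_zero).1 ⟨q.disc, by rw [key]; ring⟩
  obtain ⟨k, hk⟩ := hd
  refine hsq ⟨k, ?_⟩
  have : v 1 ^ 2 * (q.disc - k * k) = 0 := by
    rw [hk] at key; linear_combination -key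
  rcases mul_eq_zero.1 this with h2 | h2
  · exact absurd (pow_eq_zero_iff two_ne_zero |>.1 h2) h1
  · linarith

theorem sq_sqrt_disc {q : BinaryForm} (hD : 0 < q.disc) :
    √(q.disc : ℝ) ^ 2 = q.b ^ 2 - 4 * q.a * q.c := by
  rw [Real.sq_sqrt (by exact_mod_cast hD.le)]
  simp [disc]

theorem lam_mul_mu {q : BinaryForm} (hD : 0 < q.disc) (hsq : ¬ IsSquare q.disc)
    (v : Fin 2 → ℤ) : q.lam v * q.mu v = q.eval v := by
  have ha : (q.a : ℝ) ≠ 0 := by exact_mod_cast a_ne_zero hsq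
  have h := sq_sqrt_disc hD
  simp only [lam, mu, eval]
  push_cast
  field_simp
  linear_combination -(v 1 : ℝ) ^ 2 * h

theorem sqrt_disc_mul_det {q : BinaryForm} (hsq : ¬ IsSquare q.disc) (v w : Fin 2 → ℤ) :
    √(q.disc : ℝ) * det v w = q.mu v * q.lam w - q.lam v * q.mu w := by
  have ha : (q.a : ℝ) ≠ 0 := by exact_mod_cast a_ne_zero hsq
  simp only [lam, mu, det]
  push_cast
  field_simp
  ring

theorem polar_eq_lam_mu {q : BinaryForm} (hD : 0 < q.disc) (hsq : ¬ IsSquare q.disc)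
    (v w : Fin 2 → ℤ) : (q.polar v w : ℝ) = q.lam v * q.mu w + q.mu v * q.lam w := by
  simp only [polar]
  push_cast
  rw [← lam_mul_mu hD hsq, ← lam_mul_mu hD hsq, ← lam_mul_mu hD hsq, lam_add, mu_add]
  ring

theorem det_add_left (u v w : Fin 2 → ℤ) : det (u + v) w = det u w + det v w := by
  simp only [det, Pi.add_apply]; ring

theorem det_add_right (u v w : Fin 2 → ℤ) : det u (v + w) = det u v + det u w := by
  simp only [det, Pi.add_apply]; ring

theorem det_self (v : Fin 2 → ℤ) : det v v = 0 := by
  simp only [det]; ring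

theorem det_swap (v w : Fin 2 → ℤ) : det v w = -det w v := by
  simp only [det]; ring

theorem det_neg_left (v w : Fin 2 → ℤ) : det (-v) w = -det v w := by
  simp only [det, Pi.neg_apply]; ring

theorem det_neg_right (v w : Fin 2 → ℤ) : det v (-w) = -det v w := by
  simp only [det, Pi.neg_apply]; ring

theorem eq_det_smul_add {v w : Fin 2 → ℤ} (h : det v w = 1) (x : Fin 2 → ℤ) :
    x = det x w • v + det v x • w := by
  simp only [det] at h
  ext i
  fin_cases i
  · simp [det]; linear_combination -(x 0) * h
  · simp [det]; linear_combination -(x 1) * h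

theorem det_mulVec (g : SL(2, ℤ)) (v w : Fin 2 → ℤ) :
    det (g.1 *ᵥ v) (g.1 *ᵥ w) = det v w := by
  have hg := g.2
  rw [Matrix.det_fin_two] at hg
  simp only [det, Matrix.mulVec, dotProduct, Fin.sum_univ_two]
  linear_combination (v 0 * w 1 - v 1 * w 0) * hg

/-- The Plücker relation. For two bases of determinant 1 it says that the change of basis has
determinant 1. -/
theorem det_mul_det_sub (v w x y : Fin 2 → ℤ) :
    det x w * det v y - det v x * det y w = det v w * det x y := by
  simp only [det]; ring

/-! ### The period group and the equation `t² - D u² = 4` -/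

theorem lam_mulVec_of_entries {q : BinaryForm} (hD : 0 < q.disc) {g : SL(2, ℤ)} {u : ℤ}
    (h10 : g.1 1 0 = q.a * u) (h11 : g.1 1 1 = g.1 0 0 + q.b * u) (h01 : g.1 0 1 = -(q.c * u))
    (v : Fin 2 → ℤ) :
    q.lam (g.1 *ᵥ v) =
      ((2 * g.1 0 0 + q.b * u : ℤ) + u * √(q.disc : ℝ)) / 2 * q.lam v := by
  have h := sq_sqrt_disc hD
  simp only [lam, Matrix.mulVec, dotProduct, Fin.sum_univ_two, h10, h11, h01]
  push_cast
  linear_combination (-(u : ℝ) * v 1 / 4) * h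

theorem mu_mulVec_of_entries {q : BinaryForm} (hD : 0 < q.disc) (hsq : ¬ IsSquare q.disc)
    {g : SL(2, ℤ)} {u : ℤ}
    (h10 : g.1 1 0 = q.a * u) (h11 : g.1 1 1 = g.1 0 0 + q.b * u) (h01 : g.1 0 1 = -(q.c * u))
    (v : Fin 2 → ℤ) :
    q.mu (g.1 *ᵥ v) =
      ((2 * g.1 0 0 + q.b * u : ℤ) - u * √(q.disc : ℝ)) / 2 * q.mu v := by
  have ha : (q.a : ℝ) ≠ 0 := by exact_mod_cast a_ne_zero hsq
  have h := sq_sqrt_disc hD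
  simp only [mu, Matrix.mulVec, dotProduct, Fin.sum_univ_two, h10, h11, h01]
  push_cast
  field_simp
  linear_combination (-(u : ℝ) * v 1) * h

theorem exists_multiplier {q : BinaryForm} (hq : q.IsPrimitive) (hD : 0 < q.disc)
    (hsq : ¬ IsSquare q.disc) {g : SL(2, ℤ)} (hg : g ∈ Topograph.periodGroup q) :
    ∃ t u : ℤ, t ^ 2 - q.disc * u ^ 2 = 4 ∧
      (∀ v, q.lam (g.1 *ᵥ v) = (t + u * √(q.disc : ℝ)) / 2 * q.lam v) ∧
      ∀ v, q.mu (g.1 *ᵥ v) = (t - u * √(q.disc : ℝ)) / 2 * q.mu v := by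
  have hdet := g.2
  rw [Matrix.det_fin_two] at hdet
  have hg' : ∀ v : Fin 2 → ℤ, q.eval (g.1 *ᵥ v) = q.eval v := hg
  have e1 := hg' ![1, 0]
  have e2 := hg' ![0, 1]
  have e3 := hg' ![1, 1]
  obtain ⟨x, y, z, hxyz⟩ : ∃ x y z : ℤ, x * q.a + y * q.b + z * q.c = 1 := by
    have h1 := Int.gcd_eq_gcd_ab q.a (Int.gcd q.b q.c)
    have h2 := Int.gcd_eq_gcd_ab q.b q.c
    rw [show Int.gcd q.a (Int.gcd q.b q.c) = 1 from hq] at h1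
    refine ⟨Int.gcdA q.a (Int.gcd q.b q.c), Int.gcdB q.b q.c * 0 +
      Int.gcdA q.b q.c * Int.gcdB q.a (Int.gcd q.b q.c),
      Int.gcdB q.b q.c * Int.gcdB q.a (Int.gcd q.b q.c), ?_⟩
    push_cast at h1
    linear_combination -h1 - Int.gcdB q.a (Int.gcd q.b q.c) * h2
  generalize hp : g.1 0 0 = p at *
  generalize hr : g.1 0 1 = r at *
  generalize hs : g.1 1 0 = s at *
  generalize ht : g.1 1 1 = t at *
  simp only [eval, Matrix.mulVec, dotProduct, Fin.sum_univ_two, hp, hr, hs, ht,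
    Matrix.cons_val_zero, Matrix.cons_val_one, mul_one, mul_zero, add_zero, zero_add] at e1 e2 e3
  -- With `M` the Gram matrix of `polar`, invariance reads `gᵀ M = M g⁻¹`. Its entries say that `(s,
  -- t - p, -r)` is proportional to `(a, b, c)`.
  have f1 : 2 * (q.b * s) = 2 * (q.a * (t - p)) := by
    linear_combination 2 * t * e1 - s * (e3 - e1 - e2) - (2 * q.a * p + q.b * s) * hdet
  have f2 : 2 * (q.a * r) = 2 * (-(q.c * s)) := by
    linear_combination t * (e3 - e1 - e2) - 2 * s * e2 - (2 * q.a * r + q.b * t) * hdet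
  have f3 : 2 * (q.b * r) = 2 * (q.c * (p - t)) := by
    linear_combination -r * (e3 - e1 - e2) + 2 * p * e2 - (q.b * r + 2 * q.c * t) * hdet
  have g1 := mul_left_cancel₀ two_ne_zero f1
  have g2 := mul_left_cancel₀ two_ne_zero f2
  have g3 := mul_left_cancel₀ two_ne_zero f3
  -- The Bézout relation makes the factor of proportionality an integer.
  obtain ⟨u, hu⟩ : ∃ u, u = x * s + y * (t - p) - z * r := ⟨_, rfl⟩
  have h10 : s = q.a * u := by
    rw [hu]; linear_combination -s * hxyz + y * g1 + z * g2
  have h11 : t = p + q.b * u := by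
    rw [hu]; linear_combination -(t - p) * hxyz - x * g1 + z * g3
  have h01 : r = -(q.c * u) := by
    rw [hu]; linear_combination -r * hxyz + x * g2 + y * g3
  refine ⟨2 * p + q.b * u, u, ?_, fun v => ?_, fun v => ?_⟩
  · rw [h10, h11, h01] at hdet
    simp only [disc]
    linear_combination 4 * hdet
  · rw [← hs] at h10
    rw [← ht, ← hp] at h11
    rw [← hr] at h01
    rw [lam_mulVec_of_entries hD h10 h11 h01, hp]
  · rw [← hs] at h10
    rw [← ht, ← hp] at h11
    rw [← hr] at h01
    rw [mu_mulVec_of_entries hD hsq h10 h11 h01, hp]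

theorem exists_mem_periodGroup {q : BinaryForm} (hD : 0 < q.disc)
    (hsq : ¬ IsSquare q.disc) {t u : ℤ} (h : t ^ 2 - q.disc * u ^ 2 = 4) :
    ∃ g ∈ Topograph.periodGroup q,
      (∀ v, q.lam (g.1 *ᵥ v) = (t + u * √(q.disc : ℝ)) / 2 * q.lam v) ∧
      ∀ v, q.mu (g.1 *ᵥ v) = (t - u * √(q.disc : ℝ)) / 2 * q.mu v := by
  -- `t` and `b u` have the same parity, since `t² - b² u² = 4 (1 - a c u²)`.
  obtain ⟨p, hp⟩ : ∃ p, t = 2 * p + q.b * u := by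
    have h2 : (2 : ℤ) ^ 2 ∣ (t - q.b * u) * (t + q.b * u) := by
      refine ⟨1 - q.a * q.c * u ^ 2, ?_⟩
      simp only [disc] at h
      linear_combination h
    rcases Int.even_or_odd (t - q.b * u) with ⟨k, hk⟩ | ⟨k, hk⟩
    · exact ⟨k, by omega⟩
    · exfalso
      have : t + q.b * u = 2 * (k + q.b * u) + 1 := by omega
      rw [hk, this] at h2
      have h3 : (2 : ℤ) ∣ (2 * k + 1) * (2 * (k + q.b * u) + 1) :=
        (dvd_pow_self 2 two_ne_zero).trans h2
      rcases Int.prime_two.dvd_mul.1 h3 with h4 | h4 <;> omega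
  subst hp
  have hdet : Matrix.det !![p, -(q.c * u); q.a * u, p + q.b * u] = 1 := by
    rw [Matrix.det_fin_two_of]
    have : 4 * (p * (p + q.b * u) - -(q.c * u) * (q.a * u)) = 4 * 1 := by
      simp only [disc] at h
      linear_combination h
    exact mul_left_cancel₀ four_ne_zero this
  refine ⟨⟨_, hdet⟩, ?_, ?_, ?_⟩
  · intro v
    rw [Matrix.det_fin_two_of] at hdet
    simp only [eval, Matrix.mulVec, dotProduct, Fin.sum_univ_two, Matrix.of_apply,
      Matrix.cons_val', Matrix.cons_val_zero, Matrix.cons_val_one, Matrix.cons_val_fin_one]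
    linear_combination (q.a * v 0 ^ 2 + q.b * (v 0 * v 1) + q.c * v 1 ^ 2) * hdet
  · exact fun v => lam_mulVec_of_entries hD rfl rfl rfl v
  · exact fun v => mu_mulVec_of_entries hD hsq rfl rfl rfl v

/-! ### Existence of the river -/

/-- A primitive vector and a vector with values of opposite signs give rise to a river edge. -/
theorem exists_basis_of_det_pos {q : BinaryForm} (hsq : ¬ IsSquare q.disc) (d : ℕ) :
    ∀ v w : Fin 2 → ℤ, (∃ x, det v x = 1) → q.eval v * q.eval w < 0 → 0 < det v w →
      det v w ≤ d → ∃ v' w', det v' w' = 1 ∧ q.eval v' * q.eval w' < 0 := by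
  induction d with
  | zero => intro v w _ _ h h'; simp at h'; omega
  | succ d ih =>
    rintro v w ⟨x, hx⟩ hvw hpos hle
    -- Euclidean descent: `z` completes `v` to a basis, and `det z w` is the remainder of `det x w`
    -- modulo `det v w`. The sign of `q(z)` is opposite to that of `q(v)`, which ends the search, or
    -- to that of `q(w)`, which leaves a smaller determinant.
    obtain ⟨z, hz⟩ : ∃ z, z = x + (-(det x w / det v w)) • v := ⟨_, rfl⟩
    have hvz : det v z = 1 := by
      rw [← hx, hz]; simp only [det, Pi.add_apply, Pi.smul_apply, smul_eq_mul]; ring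
    have hzw : det z w = det x w % det v w := by
      have := Int.emod_add_mul_ediv (det x w) (det v w)
      have h2 : det z w = det x w - det v w * (det x w / det v w) := by
        rw [hz]
        generalize det x w / det v w = k
        simp only [det, Pi.add_apply, Pi.smul_apply, smul_eq_mul]; ring
      rw [h2]; linarith
    have h0 := Int.emod_nonneg (det x w) hpos.ne'
    have h1 := Int.emod_lt_of_pos (det x w) hpos
    have hz0 : z ≠ 0 := by rintro rfl; simp [det] at hvz
    have hqz := eval_ne_zero hsq hz0
    by_cases hs : q.eval v * q.eval z < 0
    · exact ⟨v, z, hvz, hs⟩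
    · have hv0 : q.eval v ≠ 0 := by intro h; simp [h] at hvw
      have hs' : 0 < q.eval v * q.eval z :=
        lt_of_le_of_ne (not_lt.1 hs) (mul_ne_zero hv0 hqz).symm
      have hzw' : q.eval z * q.eval w < 0 := by
        have : 0 < q.eval v ^ 2 := by positivity
        by_contra hcon
        nlinarith [mul_nonneg hs'.le (not_lt.1 hcon)]
      refine ih z w ⟨-v, by rw [det_neg_right, det_swap z v, neg_neg, hvz]⟩ hzw' ?_ (by omega)
      rw [hzw]
      -- With remainder zero, `w` would be a multiple of `z`, and the two values could not have
      -- opposite signs.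
      refine lt_of_le_of_ne h0 fun h => ?_
      rw [← h] at hzw
      have e : w = det v w • z := by
        have := eq_det_smul_add hvz w
        rw [det_swap w z, hzw] at this
        simpa using this
      have : q.eval w = det v w ^ 2 * q.eval z := by
        conv_lhs => rw [e]
        simp only [eval, Pi.smul_apply, smul_eq_mul]; ring
      rw [this] at hzw'
      nlinarith [mul_nonneg (sq_nonneg (det v w)) (sq_nonneg (q.eval z))]

theorem exists_river_basis {q : BinaryForm} (hD : 0 < q.disc) (hsq : ¬ IsSquare q.disc) :
    ∃ v w, det v w = 1 ∧ q.eval v * q.eval w < 0 := by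
  have ha := a_ne_zero hsq
  have hp : ∃ x, det ![1, 0] x = 1 := ⟨![0, 1], by simp [det]⟩
  -- `(-b, 2a)` is orthogonal to `(1, 0)` for `polar`, and its value is `-a D`.
  have he : q.eval ![1, 0] * q.eval ![-q.b, 2 * q.a] < 0 := by
    have : q.eval ![1, 0] * q.eval ![-q.b, 2 * q.a] = -(q.a ^ 2 * q.disc) := by
      simp [eval, disc]; ring
    rw [this]
    have : 0 < q.a ^ 2 := by positivity
    nlinarith
  have hd : det ![1, 0] ![-q.b, 2 * q.a] = 2 * q.a := by simp [det]
  rcases lt_or_gt_of_ne ha with h | h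
  · refine exists_basis_of_det_pos hsq (-(2 * q.a)).toNat ![1, 0] (-![-q.b, 2 * q.a]) hp ?_ ?_ ?_
    · rwa [eval_neg]
    · rw [det_neg_right, hd]; omega
    · rw [det_neg_right, hd]; omega
  · exact exists_basis_of_det_pos hsq (2 * q.a).toNat _ _ hp he (by omega) (by omega)

/-! ### River pairs and the walk along the river -/

/-- A positively oriented basis with labels of opposite signs, normalised so that `lam` is
positive on both vectors. -/
structure IsRiverPair (q : BinaryForm) (p : (Fin 2 → ℤ) × (Fin 2 → ℤ)) : Prop where
  det_eq : det p.1 p.2 = 1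
  lam_fst : 0 < q.lam p.1
  lam_snd : 0 < q.lam p.2
  mu_fst : 0 < q.mu p.1
  mu_snd : q.mu p.2 < 0

/-- The next edge along the river. -/
def step (q : BinaryForm) (p : (Fin 2 → ℤ) × (Fin 2 → ℤ)) : (Fin 2 → ℤ) × (Fin 2 → ℤ) :=
  if 0 < q.eval (p.1 + p.2) then (p.1 + p.2, p.2) else (p.1, p.1 + p.2)

/-- The action of `SL(2, ℤ)` on pairs of vectors. -/
def act (g : SL(2, ℤ)) (p : (Fin 2 → ℤ) × (Fin 2 → ℤ)) : (Fin 2 → ℤ) × (Fin 2 → ℤ) :=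
  (g.1 *ᵥ p.1, g.1 *ᵥ p.2)

theorem act_mul (g h : SL(2, ℤ)) (p : (Fin 2 → ℤ) × (Fin 2 → ℤ)) :
    act (g * h) p = act g (act h p) := by
  simp only [act, Matrix.SpecialLinearGroup.coe_mul, Matrix.mulVec_mulVec]

theorem act_one (p : (Fin 2 → ℤ) × (Fin 2 → ℤ)) : act 1 p = p := by
  simp [act]

theorem step_act {q : BinaryForm} {g : SL(2, ℤ)} (hg : g ∈ Topograph.periodGroup q)
    (p : (Fin 2 → ℤ) × (Fin 2 → ℤ)) : q.step (act g p) = act g (q.step p) := by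
  have hg' : ∀ v : Fin 2 → ℤ, q.eval (g.1 *ᵥ v) = q.eval v := hg
  unfold step act
  simp only [← Matrix.mulVec_add, hg']
  split_ifs <;> rfl

theorem step_iterate_act {q : BinaryForm} {g : SL(2, ℤ)} (hg : g ∈ Topograph.periodGroup q)
    (n : ℕ) (p : (Fin 2 → ℤ) × (Fin 2 → ℤ)) : q.step^[n] (act g p) = act g (q.step^[n] p) := by
  induction n with
  | zero => rfl
  | succ n ih => rw [Function.iterate_succ_apply', ih, step_act hg, Function.iterate_succ_apply' q.step n p]

theorem exists_lam_pos {q : BinaryForm} (hD : 0 < q.disc) (hsq : ¬ IsSquare q.disc)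
    {v : Fin 2 → ℤ} (hv : q.eval v ≠ 0) : ∃ v', (v' = v ∨ v' = -v) ∧ 0 < q.lam v' := by
  rcases lt_trichotomy (q.lam v) 0 with h | h | h
  · exact ⟨-v, Or.inr rfl, by rw [lam_neg]; linarith⟩
  · have := lam_mul_mu hD hsq v
    rw [h, zero_mul] at this
    exact absurd (by exact_mod_cast this.symm) hv
  · exact ⟨v, Or.inl rfl, h⟩

theorem exists_isRiverPair {q : BinaryForm} (hD : 0 < q.disc) (hsq : ¬ IsSquare q.disc) :
    ∃ p, q.IsRiverPair p := by
  have main : ∀ v w, IsUnit (det v w) → 0 < q.eval v → q.eval w < 0 → ∃ p, q.IsRiverPair p := by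
    intro v w hu hv hw
    obtain ⟨v', hv', hlv⟩ := exists_lam_pos hD hsq hv.ne'
    obtain ⟨w', hw', hlw⟩ := exists_lam_pos hD hsq hw.ne
    have ev : (0 : ℝ) < q.eval v' := by
      rcases hv' with rfl | rfl <;> [skip; rw [eval_neg]] <;> exact_mod_cast hv
    have ew : (q.eval w' : ℝ) < 0 := by
      rcases hw' with rfl | rfl <;> [skip; rw [eval_neg]] <;> exact_mod_cast hw
    rw [← lam_mul_mu hD hsq] at ev ew
    have mv : 0 < q.mu v' := (pos_iff_pos_of_mul_pos ev).1 hlv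
    have mw : q.mu w' < 0 := by
      by_contra h
      exact absurd (mul_nonneg hlw.le (not_lt.1 h)) (not_le.2 ew)
    have hu' : IsUnit (det v' w') := by
      rcases hv' with rfl | rfl <;> rcases hw' with rfl | rfl <;>
        simpa [det_neg_left, det_neg_right] using hu
    refine ⟨(v', w'), ?_, hlv, hlw, mv, mw⟩
    -- The orientation is automatic: the signs of `lam` and `mu` force a positive determinant.
    have hdet := sqrt_disc_mul_det hsq v' w'
    rcases Int.isUnit_iff.1 hu' with h | h
    · exact h
    · exfalso
      rw [h] at hdet
      push_cast at hdet
      nlinarith [mul_pos mv hlw, mul_pos hlv (neg_pos.2 mw), Real.sqrt_nonneg (q.disc : ℝ)]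
  obtain ⟨v, w, hdet, hvw⟩ := exists_river_basis hD hsq
  rcases mul_neg_iff.1 hvw with ⟨h1, h2⟩ | ⟨h1, h2⟩
  · exact main v w (by simp [hdet]) h1 h2
  · exact main w v (by simp [det_swap w v, hdet]) h2 h1

variable {q : BinaryForm} {p p' : (Fin 2 → ℤ) × (Fin 2 → ℤ)}

namespace IsRiverPair

theorem lam_add_pos (h : q.IsRiverPair p) : 0 < q.lam (p.1 + p.2) := by
  rw [lam_add]; exact add_pos h.lam_fst h.lam_snd

theorem eval_add_ne_zero (h : q.IsRiverPair p) (hsq : ¬ IsSquare q.disc) :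
    q.eval (p.1 + p.2) ≠ 0 := by
  refine eval_ne_zero hsq fun h0 => ?_
  have := h.lam_add_pos
  rw [h0] at this
  simp [lam] at this

theorem mu_add_pos (h : q.IsRiverPair p) (hD : 0 < q.disc) (hsq : ¬ IsSquare q.disc)
    (hpos : 0 < q.eval (p.1 + p.2)) : 0 < q.mu (p.1 + p.2) := by
  have h1 : (0 : ℝ) < q.eval (p.1 + p.2) := by exact_mod_cast hpos
  rw [← lam_mul_mu hD hsq] at h1
  exact (pos_iff_pos_of_mul_pos h1).1 h.lam_add_pos

theorem mu_add_neg (h : q.IsRiverPair p) (hD : 0 < q.disc) (hsq : ¬ IsSquare q.disc)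
    (hneg : ¬ 0 < q.eval (p.1 + p.2)) : q.mu (p.1 + p.2) < 0 := by
  have h0 := h.eval_add_ne_zero hsq
  have h1 : (q.eval (p.1 + p.2) : ℝ) < 0 := by
    exact_mod_cast lt_of_le_of_ne (not_lt.1 hneg) h0
  rw [← lam_mul_mu hD hsq] at h1
  by_contra hcon
  exact absurd (mul_nonneg h.lam_add_pos.le (not_lt.1 hcon)) (not_le.2 h1)

theorem step (h : q.IsRiverPair p) (hD : 0 < q.disc) (hsq : ¬ IsSquare q.disc) :
    q.IsRiverPair (q.step p) := by
  unfold BinaryForm.step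
  split_ifs with hpos
  · exact ⟨by rw [det_add_left, det_self, h.det_eq, add_zero], h.lam_add_pos, h.lam_snd,
      h.mu_add_pos hD hsq hpos, h.mu_snd⟩
  · exact ⟨by rw [det_add_right, det_self, h.det_eq, zero_add], h.lam_fst, h.lam_add_pos,
      h.mu_fst, h.mu_add_neg hD hsq hpos⟩

theorem iterate_step (h : q.IsRiverPair p) (hD : 0 < q.disc) (hsq : ¬ IsSquare q.disc) (n : ℕ) :
    q.IsRiverPair (q.step^[n] p) := by
  induction n with
  | zero => exact h
  | succ n ih => rw [Function.iterate_succ_apply']; exact ih.step hD hsq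

theorem det_pos (h : q.IsRiverPair p) (h' : q.IsRiverPair p') (hD : 0 < q.disc)
    (hsq : ¬ IsSquare q.disc) : 0 < det p.1 p'.2 := by
  have hdet := sqrt_disc_mul_det hsq p.1 p'.2
  have h1 : 0 < √(q.disc : ℝ) * det p.1 p'.2 := by
    rw [hdet]
    nlinarith [mul_pos h.mu_fst h'.lam_snd, mul_pos h.lam_fst (neg_pos.2 h'.mu_snd)]
  have h2 : 0 < √(q.disc : ℝ) := Real.sqrt_pos.2 (by exact_mod_cast hD)
  exact_mod_cast (pos_iff_pos_of_mul_pos h1).1 h2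

/-- If the cone of `p'` lies in the cone of `p`, then `p'` lies downstream of `p`. -/
theorem exists_iterate_step (hD : 0 < q.disc) (hsq : ¬ IsSquare q.disc)
    (h' : q.IsRiverPair p') (N : ℕ) :
    ∀ p, q.IsRiverPair p → 0 ≤ det p.1 p'.1 → 0 ≤ det p'.2 p.2 →
      det p.1 p'.1 + det p'.2 p.2 ≤ N → ∃ n, q.step^[n] p = p' := by
  induction N with
  | zero =>
    intro p h h1 h2 hN
    have e1 : det p.1 p'.1 = 0 := by simp at hN; omega
    have e2 : det p'.2 p.2 = 0 := by simp at hN; omega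
    refine ⟨0, ?_⟩
    -- In the basis `p`, the pair `p'` has the coordinate matrix with rows `(A, α)` and `(δ, B)`,
    -- where `A, B > 0` and `A B - α δ = 1`. Here `α = δ = 0`, so it is the identity.
    have k1 := det_mul_det_sub p.1 p.2 p'.1 p'.2
    rw [e1, e2, h.det_eq, h'.det_eq] at k1
    have k2 := h.det_pos h' hD hsq
    have k3 := h'.det_pos h hD hsq
    have k4 : det p'.1 p.2 * det p.1 p'.2 = 1 := by linarith
    have k5 := Int.eq_one_or_neg_one_of_mul_eq_one k4
    have k6 : det p'.1 p.2 = 1 := by omega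
    rw [k6, one_mul] at k4
    have r1 := eq_det_smul_add h.det_eq p'.1
    have r2 := eq_det_smul_add h.det_eq p'.2
    rw [e1, k6, one_smul, zero_smul, add_zero] at r1
    rw [e2, k4, one_smul, zero_smul, zero_add] at r2
    exact Prod.ext r1.symm r2.symm
  | succ N ih =>
    intro p h h1 h2 hN
    rcases (add_nonneg h1 h2).eq_or_lt with h0 | h0
    · exact ih p h h1 h2 (by omega)
    have hs := h.step hD hsq
    have k1 := det_mul_det_sub p.1 p.2 p'.1 p'.2
    rw [h.det_eq, h'.det_eq] at k1
    have k2 := h.det_pos h' hD hsq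
    have k3 := h'.det_pos h hD hsq
    have k4 := hs.det_pos h' hD hsq
    have k5 := h'.det_pos hs hD hsq
    suffices 0 ≤ det (q.step p).1 p'.1 ∧ 0 ≤ det p'.2 (q.step p).2 ∧
        det (q.step p).1 p'.1 + det p'.2 (q.step p).2 ≤ N by
      obtain ⟨n, hn⟩ := ih _ hs this.1 this.2.1 this.2.2
      exact ⟨n + 1, by rwa [Function.iterate_succ_apply]⟩
    have s1 := det_swap p.2 p'.1
    have s2 := det_swap p.2 p'.2
    have s3 := det_swap p'.2 p.1
    have s4 := det_swap p'.1 p.1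
    unfold BinaryForm.step at k4 k5 ⊢
    push_cast at hN
    by_cases hpos : 0 < q.eval (p.1 + p.2)
    · simp only [if_pos hpos, det_add_left] at k4 k5 ⊢
      refine ⟨?_, h2, by omega⟩
      -- If `α < A`, then, as the new pair also gives `δ < B`, `A B - α δ = 1` forces `A = B = 1`
      -- and `α = δ = 0`, against `h0`. So the step subtracts `A ≥ 1` from `α` and keeps the
      -- coordinates nonnegative; the other case is symmetric.
      by_contra hcon
      nlinarith [mul_nonneg h1 h2, mul_nonneg (show 0 ≤ det p'.1 p.2 - det p.1 p'.1 - 1 by omega)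
        (show 0 ≤ det p.1 p'.2 by omega), mul_nonneg h1
          (show 0 ≤ det p.1 p'.2 - det p'.2 p.2 - 1 by omega)]
    · simp only [if_neg hpos, det_add_right] at k4 k5 ⊢
      refine ⟨h1, ?_, by omega⟩
      by_contra hcon
      nlinarith [mul_nonneg h1 h2, mul_nonneg (show 0 ≤ det p.1 p'.2 - det p'.2 p.2 - 1 by omega)
        (show 0 ≤ det p'.1 p.2 by omega), mul_nonneg h2
          (show 0 ≤ det p'.1 p.2 - det p.1 p'.1 - 1 by omega)]

end IsRiverPair

/-! ### Multipliers and the fundamental unit -/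

/-- `g` scales the two linear factors of the form by `η` and `η⁻¹`. -/
def HasMultiplier (q : BinaryForm) (g : SL(2, ℤ)) (η : ℝ) : Prop :=
  (∀ v, q.lam (g.1 *ᵥ v) = η * q.lam v) ∧ ∀ v, q.mu (g.1 *ᵥ v) = η⁻¹ * q.mu v

theorem HasMultiplier.mul {q : BinaryForm} {g h : SL(2, ℤ)} {η θ : ℝ}
    (hg : q.HasMultiplier g η) (hh : q.HasMultiplier h θ) : q.HasMultiplier (g * h) (η * θ) := by
  constructor
  · intro v
    rw [Matrix.SpecialLinearGroup.coe_mul, ← Matrix.mulVec_mulVec, hg.1, hh.1, mul_assoc]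
  · intro v
    rw [Matrix.SpecialLinearGroup.coe_mul, ← Matrix.mulVec_mulVec, hg.2, hh.2, mul_inv, mul_assoc]

theorem HasMultiplier.pow {q : BinaryForm} {g : SL(2, ℤ)} {η : ℝ}
    (hg : q.HasMultiplier g η) (k : ℕ) : q.HasMultiplier (g ^ k) (η ^ k) := by
  induction k with
  | zero => simp [HasMultiplier]
  | succ k ih => rw [pow_succ, pow_succ]; exact ih.mul hg

theorem HasMultiplier.neg {q : BinaryForm} {g : SL(2, ℤ)} {η : ℝ}
    (hg : q.HasMultiplier g η) : q.HasMultiplier (-g) (-η) := by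
  constructor
  · intro v
    rw [Matrix.SpecialLinearGroup.coe_neg, Matrix.neg_mulVec, lam_neg, hg.1, neg_mul]
  · intro v
    rw [Matrix.SpecialLinearGroup.coe_neg, Matrix.neg_mulVec, mu_neg, hg.2, inv_neg, neg_mul]

theorem neg_mem_periodGroup {q : BinaryForm} {g : SL(2, ℤ)} (hg : g ∈ Topograph.periodGroup q) :
    -g ∈ Topograph.periodGroup q := by
  intro v
  rw [Matrix.SpecialLinearGroup.coe_neg, Matrix.neg_mulVec, eval_neg]
  exact hg v

theorem HasMultiplier.isRiverPair_act {q : BinaryForm} {p : (Fin 2 → ℤ) × (Fin 2 → ℤ)}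
    {g : SL(2, ℤ)} {η : ℝ} (hg : q.HasMultiplier g η) (hη : 0 < η) (h : q.IsRiverPair p) :
    q.IsRiverPair (act g p) where
  det_eq := by rw [act, det_mulVec, h.det_eq]
  lam_fst := by rw [act, hg.1]; exact mul_pos hη h.lam_fst
  lam_snd := by rw [act, hg.1]; exact mul_pos hη h.lam_snd
  mu_fst := by rw [act, hg.2]; exact mul_pos (inv_pos.2 hη) h.mu_fst
  mu_snd := by rw [act, hg.2]; exact mul_neg_of_pos_of_neg (inv_pos.2 hη) h.mu_snd

theorem inv_unit_eq {D : ℤ} (hD : 0 < D) {t u : ℤ} (h : t ^ 2 - D * u ^ 2 = 4) :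
    ((t + u * √(D : ℝ)) / 2)⁻¹ = (t - u * √(D : ℝ)) / 2 := by
  apply inv_eq_of_mul_eq_one_right
  have h1 : √(D : ℝ) ^ 2 = D := Real.sq_sqrt (by exact_mod_cast hD.le)
  have h2 : (t : ℝ) ^ 2 - D * u ^ 2 = 4 := by exact_mod_cast h
  linear_combination (1 / 4 : ℝ) * h2 - (u : ℝ) ^ 2 / 4 * h1

theorem exists_hasMultiplier_epsilon (hD : 0 < q.disc) (hsq : ¬ IsSquare q.disc) :
    ∃ g ∈ Topograph.periodGroup q, q.HasMultiplier g (FundamentalUnit.epsilon q.disc) := by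
  have h := (FundamentalUnit.isSolution_min hD hsq).2.2
  obtain ⟨g, hg, h1, h2⟩ := exists_mem_periodGroup hD hsq h
  have h3 := inv_unit_eq hD h
  refine ⟨g, hg, fun v => ?_, fun v => ?_⟩
  · rw [h1, FundamentalUnit.epsilon]; push_cast; ring
  · rw [h2, ← h3, FundamentalUnit.epsilon]; push_cast; ring

theorem one_lt_epsilon {D : ℤ} (hD : 0 < D) (hsq : ¬ IsSquare D) :
    1 < FundamentalUnit.epsilon D := by
  obtain ⟨ht, hu, h⟩ := FundamentalUnit.isSolution_min hD hsq
  have hs : 0 < √(D : ℝ) := Real.sqrt_pos.2 (by exact_mod_cast hD)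
  have ht2 : (2 : ℝ) ≤ FundamentalUnit.tMin D := by
    have : (2 : ℤ) ≤ FundamentalUnit.tMin D := by
      by_contra hcon
      have h1 : (FundamentalUnit.tMin D : ℤ) = 1 := by omega
      rw [h1] at h
      nlinarith [mul_nonneg hD.le (sq_nonneg (FundamentalUnit.uMin D : ℤ))]
    exact_mod_cast this
  have hu1 : (0 : ℝ) < FundamentalUnit.uMin D := by exact_mod_cast hu
  have := mul_pos hu1 hs
  rw [FundamentalUnit.epsilon]
  linarith

/-- The conjugate is the inverse, which lies in `(0, 1)`; adding and subtracting the two gives `t >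
0` and `u > 0`. Both are then at least the minimal values. -/
theorem epsilon_le_of_one_lt {D : ℤ} (hD : 0 < D) {t u : ℤ} (h : t ^ 2 - D * u ^ 2 = 4)
    (h1 : 1 < (t + u * √(D : ℝ)) / 2) :
    FundamentalUnit.epsilon D ≤ (t + u * √(D : ℝ)) / 2 := by
  have hs : 0 < √(D : ℝ) := Real.sqrt_pos.2 (by exact_mod_cast hD)
  have hinv := inv_unit_eq hD h
  have hi0 := inv_pos.2 (zero_lt_one.trans h1)
  have hi1 := inv_lt_one_of_one_lt₀ h1
  rw [hinv] at hi0 hi1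
  have ht : 0 < t := by
    have : (0 : ℝ) < t := by linarith
    exact_mod_cast this
  have hu : 0 < u := by
    have : (0 : ℝ) < u * √(D : ℝ) := by linarith
    exact_mod_cast (pos_iff_pos_of_mul_pos this).2 hs
  lift t to ℕ using ht.le
  lift u to ℕ using hu.le
  have hsol : FundamentalUnit.IsSolution D t u := ⟨by exact_mod_cast ht, by exact_mod_cast hu, h⟩
  have l1 : FundamentalUnit.tMin D ≤ t := Nat.sInf_le ⟨u, hsol⟩
  have l2 : FundamentalUnit.uMin D ≤ u := Nat.sInf_le ⟨t, hsol⟩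
  rw [FundamentalUnit.epsilon, Int.cast_natCast, Int.cast_natCast]
  gcongr

theorem exists_hasMultiplier (hq : q.IsPrimitive) (hD : 0 < q.disc)
    (hsq : ¬ IsSquare q.disc) {g : SL(2, ℤ)} (hg : g ∈ Topograph.periodGroup q) :
    ∃ η, η ≠ 0 ∧ q.HasMultiplier g η ∧ (1 < η → FundamentalUnit.epsilon q.disc ≤ η) := by
  obtain ⟨t, u, h, h1, h2⟩ := exists_multiplier hq hD hsq hg
  have hinv := inv_unit_eq hD h
  refine ⟨_, ?_, ⟨h1, by rwa [hinv]⟩, epsilon_le_of_one_lt hD h⟩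
  intro h0
  have h3 := h1 ((g⁻¹).1 *ᵥ ![1, 0])
  rw [h0, zero_mul, Matrix.mulVec_mulVec, ← Matrix.SpecialLinearGroup.coe_mul] at h3
  simp [lam, a_ne_zero hsq] at h3

/-! ### Periodicity of the river -/

theorem IsRiverPair.lam_lt_step (h : q.IsRiverPair p) :
    q.lam p.1 + q.lam p.2 < q.lam (q.step p).1 + q.lam (q.step p).2 := by
  have h1 := h.lam_fst
  have h2 := h.lam_snd
  unfold BinaryForm.step
  split_ifs <;> simp only [lam_add] <;> linarith

theorem IsRiverPair.strictMono_lam (h : q.IsRiverPair p) (hD : 0 < q.disc)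
    (hsq : ¬ IsSquare q.disc) :
    StrictMono fun n => q.lam (q.step^[n] p).1 + q.lam (q.step^[n] p).2 := by
  refine strictMono_nat_of_lt_succ fun n => ?_
  rw [Function.iterate_succ_apply']
  exact (h.iterate_step hD hsq n).lam_lt_step

/-- The two inequalities make the off-diagonal coordinates of `act g p'` in the basis `p`
nonnegative. They hold for `p' = p` and every `η ≥ 1`, and for any river pair `p'` once `η` is
large. -/
theorem IsRiverPair.exists_iterate_step_eq_act (h : q.IsRiverPair p) (h' : q.IsRiverPair p')
    (hD : 0 < q.disc) (hsq : ¬ IsSquare q.disc) {g : SL(2, ℤ)} {η : ℝ}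
    (hg : q.HasMultiplier g η) (hη : 1 ≤ η)
    (hfst : q.lam p.1 * q.mu p'.1 ≤ η * (q.mu p.1 * q.lam p'.1))
    (hsnd : q.lam p.2 * -q.mu p'.2 ≤ η * (-q.mu p.2 * q.lam p'.2)) :
    ∃ n, q.step^[n] p = act g p' := by
  have hη0 : 0 < η := by linarith
  have hs : 0 < √(q.disc : ℝ) := Real.sqrt_pos.2 (by exact_mod_cast hD)
  have hi : η⁻¹ ≤ 1 := inv_le_one_of_one_le₀ hη
  have hr := hg.isRiverPair_act hη0 h'
  have nonneg : ∀ {n : ℤ}, 0 ≤ √(q.disc : ℝ) * n → 0 ≤ n := fun hn => by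
    exact_mod_cast nonneg_of_mul_nonneg_right hn hs
  refine exists_iterate_step hD hsq hr
    (det p.1 (act g p').1 + det (act g p').2 p.2).toNat p h ?_ ?_ (Int.self_le_toNat _)
  · apply nonneg
    rw [sqrt_disc_mul_det hsq, act, hg.1, hg.2]
    nlinarith [mul_le_mul_of_nonneg_right hi (mul_pos h.lam_fst h'.mu_fst).le]
  · apply nonneg
    rw [sqrt_disc_mul_det hsq, act, hg.1, hg.2]
    nlinarith [mul_le_mul_of_nonneg_right hi (mul_pos h.lam_snd (neg_pos.2 h'.mu_snd)).le]

/-- After one period the river comes back to its beginning, up to the action of a generator of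
the period group modulo `±1`. -/
theorem IsRiverPair.exists_period (h : q.IsRiverPair p) (hq : q.IsPrimitive) (hD : 0 < q.disc)
    (hsq : ¬ IsSquare q.disc) :
    ∃ n, 0 < n ∧ (∃ g ∈ Topograph.periodGroup q,
        q.HasMultiplier g (FundamentalUnit.epsilon q.disc) ∧ q.step^[n] p = act g p) ∧
      ∀ m, 0 < m → (∃ g ∈ Topograph.periodGroup q, q.step^[m] p = act g p) → n ≤ m := by
  classical
  have he := one_lt_epsilon hD hsq
  have hlam : ∀ {g η}, q.HasMultiplier g η → q.lam (act g p).1 + q.lam (act g p).2 =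
      η * (q.lam p.1 + q.lam p.2) := fun hg => by simp only [act, hg.1]; ring
  have hpos : 0 < q.lam p.1 + q.lam p.2 := add_pos h.lam_fst h.lam_snd
  have hmono := h.strictMono_lam hD hsq
  obtain ⟨γ, hγ, hγε⟩ := exists_hasMultiplier_epsilon hD hsq
  have hex : ∃ m, 0 < m ∧ q.step^[m] p = act γ p := by
    obtain ⟨m, hm⟩ := h.exists_iterate_step_eq_act h hD hsq hγε he.le
      (by nlinarith [mul_pos h.lam_fst h.mu_fst])
      (by nlinarith [mul_pos h.lam_snd (neg_pos.2 h.mu_snd)])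
    refine ⟨m, Nat.pos_of_ne_zero ?_, hm⟩
    rintro rfl
    have := hlam hγε
    rw [← hm, Function.iterate_zero_apply] at this
    nlinarith
  obtain ⟨m, hm0, hm⟩ := hex
  have hex' : ∃ n, 0 < n ∧ ∃ g ∈ Topograph.periodGroup q, q.step^[n] p = act g p :=
    ⟨m, hm0, γ, hγ, hm⟩
  obtain ⟨hn0, g, hg, hn⟩ := Nat.find_spec hex'
  have hmin : ∀ m, 0 < m → (∃ g ∈ Topograph.periodGroup q, q.step^[m] p = act g p) →
      Nat.find hex' ≤ m := fun m hm hg => Nat.find_min' hex' ⟨hm, hg⟩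
  refine ⟨Nat.find hex', hn0, ⟨g, hg, ?_, hn⟩, hmin⟩
  obtain ⟨η, -, hη, hηε⟩ := exists_hasMultiplier hq hD hsq hg
  -- The sum of the two `lam` values grows strictly along the river. So `n > 0` gives `η > 1`, hence
  -- `η ≥ ε_D`, while `n ≤ m` gives `η ≤ ε_D`.
  have h1 := hmono hn0
  have h2 := hmono.monotone (hmin m hm0 ⟨γ, hγ, hm⟩)
  simp only [hn, hm, hlam hη, hlam hγε, Function.iterate_zero_apply] at h1 h2
  have h3 : 1 < η := by
    by_contra hcon
    nlinarith
  rwa [le_antisymm (hηε h3) (le_of_mul_le_mul_right h2 hpos)]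

theorem iterate_step_mul {g : SL(2, ℤ)} (hg : g ∈ Topograph.periodGroup q) {n : ℕ}
    (hn : q.step^[n] p = act g p) (j : ℕ) : q.step^[n * j] p = act (g ^ j) p := by
  induction j with
  | zero => simp [act_one]
  | succ j ih =>
    rw [Nat.mul_succ, Function.iterate_add_apply, hn, step_iterate_act hg, ih, ← act_mul,
      pow_succ']

/-- Modulo the period, every river pair occurs among the first `n` ones. -/
theorem IsRiverPair.exists_eq_act_iterate (h : q.IsRiverPair p) (h' : q.IsRiverPair p')
    (hD : 0 < q.disc) (hsq : ¬ IsSquare q.disc) {n : ℕ} (hn0 : 0 < n) {g : SL(2, ℤ)}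
    (hg : g ∈ Topograph.periodGroup q)
    (hε : q.HasMultiplier g (FundamentalUnit.epsilon q.disc)) (hn : q.step^[n] p = act g p) :
    ∃ i < n, ∃ k ∈ Topograph.periodGroup q, p' = act k (q.step^[i] p) := by
  have he := one_lt_epsilon hD hsq
  have h1 : 0 < q.mu p.1 * q.lam p'.1 := mul_pos h.mu_fst h'.lam_fst
  have h2 : 0 < -q.mu p.2 * q.lam p'.2 := mul_pos (neg_pos.2 h.mu_snd) h'.lam_snd
  -- Push `p'` downstream of `p` by a high power of the period.
  obtain ⟨k, hk⟩ := pow_unbounded_of_one_lt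
    (max (q.lam p.1 * q.mu p'.1 / (q.mu p.1 * q.lam p'.1))
      (q.lam p.2 * -q.mu p'.2 / (-q.mu p.2 * q.lam p'.2))) he
  obtain ⟨hk1, hk2⟩ := max_lt_iff.1 hk
  obtain ⟨m, hm⟩ := h.exists_iterate_step_eq_act h' hD hsq (hε.pow k) (one_le_pow₀ he.le)
    ((div_lt_iff₀ h1).1 hk1).le ((div_lt_iff₀ h2).1 hk2).le
  refine ⟨m % n, Nat.mod_lt _ hn0, (g ^ k)⁻¹ * g ^ (m / n),
    mul_mem (inv_mem (pow_mem hg _)) (pow_mem hg _), ?_⟩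
  rw [act_mul, ← step_iterate_act (pow_mem hg _), ← iterate_step_mul hg hn,
    ← Function.iterate_add_apply, Nat.mod_add_div, hm, ← act_mul, inv_mul_cancel, act_one]

/-! ### The potential and the arctanh terms -/

/-- The potential whose increments are the contributions of the bank edges. -/
noncomputable def potential (q : BinaryForm) (p : (Fin 2 → ℤ) × (Fin 2 → ℤ)) : ℝ :=
  Real.log (q.lam p.1) - Real.log (q.mu p.1) + (Real.log (q.lam p.2) - Real.log (q.mu p.2))

/-- Each of the four logarithms contributes `log η`. Since `Real.log x = log |x|`, the negative `mu
p.2` does no harm. -/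
theorem IsRiverPair.potential_act (h : q.IsRiverPair p) {g : SL(2, ℤ)} {η : ℝ} (hη : 0 < η)
    (hg : q.HasMultiplier g η) : q.potential (act g p) = q.potential p + 4 * Real.log η := by
  simp only [potential, act, hg.1, hg.2]
  rw [Real.log_mul hη.ne' h.lam_fst.ne', Real.log_mul hη.ne' h.lam_snd.ne',
    Real.log_mul (inv_pos.2 hη).ne' h.mu_fst.ne', Real.log_mul (inv_pos.2 hη).ne' h.mu_snd.ne,
    Real.log_inv]
  ring

/-- The basis of the bank edge at the vertex of the superbase `p.1, p.2, -(p.1 + p.2)`. -/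
def bankPair (q : BinaryForm) (p : (Fin 2 → ℤ) × (Fin 2 → ℤ)) : (Fin 2 → ℤ) × (Fin 2 → ℤ) :=
  if 0 < q.eval (p.1 + p.2) then (p.1, p.1 + p.2) else (p.1 + p.2, p.2)

theorem artanh_div_eq {s e : ℝ} (hs : 0 < s) (hse : s < e) :
    Real.artanh (s / e) = (Real.log (e + s) - Real.log (e - s)) / 2 := by
  have he : 0 < e := hs.trans hse
  have h1 : s / e < 1 := (div_lt_one he).2 hse
  rw [Real.artanh_eq_half_log ⟨by linarith [div_pos hs he], h1.le⟩,
    ← Real.log_div (by linarith) (by linarith)]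
  have : (1 + s / e) / (1 - s / e) = (e + s) / (e - s) := by
    have : e - s ≠ 0 := by linarith
    field_simp
  rw [this]; ring

theorem IsRiverPair.det_bankPair (h : q.IsRiverPair p) :
    det (q.bankPair p).1 (q.bankPair p).2 = 1 := by
  unfold bankPair
  split_ifs
  · rw [det_add_right, det_self, h.det_eq, zero_add]
  · rw [det_add_left, det_self, h.det_eq, add_zero]

theorem IsRiverPair.lam_bankPair (h : q.IsRiverPair p) :
    0 < q.lam (q.bankPair p).1 ∧ 0 < q.lam (q.bankPair p).2 := by
  unfold bankPair
  split_ifs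
  · exact ⟨h.lam_fst, h.lam_add_pos⟩
  · exact ⟨h.lam_add_pos, h.lam_snd⟩

theorem IsRiverPair.mu_bankPair (h : q.IsRiverPair p) (hD : 0 < q.disc)
    (hsq : ¬ IsSquare q.disc) :
    (0 < q.mu (q.bankPair p).1 ∧ 0 < q.mu (q.bankPair p).2 ∧ q.bankPair p = (p.1, p.1 + p.2)) ∨
      (q.mu (q.bankPair p).1 < 0 ∧ q.mu (q.bankPair p).2 < 0 ∧
        q.bankPair p = (p.1 + p.2, p.2)) := by
  unfold bankPair
  split_ifs with hpos
  · exact Or.inl ⟨h.mu_fst, h.mu_add_pos hD hsq hpos, rfl⟩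
  · exact Or.inr ⟨h.mu_add_neg hD hsq hpos, h.mu_snd, rfl⟩

/-- For the bank basis `x, y`, `|e| ± √D` are twice the absolute values of `mu x * lam y` and `lam x
* mu y`, in an order that depends on the bank. The logarithm of their ratio compares `p.1 + p.2`
with the vector that `step` discards. -/
theorem IsRiverPair.sqrt_lt_and_artanh_eq (h : q.IsRiverPair p) (hD : 0 < q.disc)
    (hsq : ¬ IsSquare q.disc) :
    √(q.disc : ℝ) < (|q.polar (q.bankPair p).1 (q.bankPair p).2| : ℤ) ∧
    Real.artanh (√(q.disc : ℝ) / (|q.polar (q.bankPair p).1 (q.bankPair p).2| : ℤ)) =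
      (q.potential (q.step p) - q.potential p) / 2 := by
  have hs : 0 < √(q.disc : ℝ) := Real.sqrt_pos.2 (by exact_mod_cast hD)
  have hdet := sqrt_disc_mul_det hsq (q.bankPair p).1 (q.bankPair p).2
  rw [h.det_bankPair, Int.cast_one, mul_one] at hdet
  have hpot : q.potential (q.step p) - q.potential p =
      if 0 < q.eval (p.1 + p.2) then
        Real.log (q.lam (p.1 + p.2)) - Real.log (q.mu (p.1 + p.2)) -
          (Real.log (q.lam p.1) - Real.log (q.mu p.1))
      else Real.log (q.lam (p.1 + p.2)) - Real.log (q.mu (p.1 + p.2)) -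
          (Real.log (q.lam p.2) - Real.log (q.mu p.2)) := by
    unfold potential BinaryForm.step
    split_ifs <;> ring
  rw [Int.cast_abs, polar_eq_lam_mu hD hsq, hpot]
  obtain ⟨hx, hy⟩ := h.lam_bankPair
  unfold bankPair at *
  by_cases hpos : 0 < q.eval (p.1 + p.2)
  · simp only [if_pos hpos] at *
    have hmx := h.mu_fst
    have hmy := h.mu_add_pos hD hsq hpos
    generalize q.lam (p.1 + p.2) = b at *
    generalize q.mu (p.1 + p.2) = d at *
    generalize q.lam p.1 = a at *
    generalize q.mu p.1 = c at *
    have h1 := mul_pos hx hmy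
    have h2 := mul_pos hmx hy
    have hlt : √(q.disc : ℝ) < |a * d + c * b| := by
      rw [abs_of_pos (by linarith)]; linarith
    refine ⟨hlt, ?_⟩
    rw [artanh_div_eq hs hlt, abs_of_pos (by linarith), hdet,
      show a * d + c * b + (c * b - a * d) = 2 * (c * b) by ring,
      show a * d + c * b - (c * b - a * d) = 2 * (a * d) by ring,
      Real.log_mul two_ne_zero h1.ne', Real.log_mul two_ne_zero h2.ne',
      Real.log_mul hx.ne' hmy.ne', Real.log_mul hmx.ne' hy.ne']
    ring
  · simp only [if_neg hpos] at *
    have hmx := h.mu_add_neg hD hsq hpos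
    have hmy := h.mu_snd
    generalize q.lam (p.1 + p.2) = a at *
    generalize q.mu (p.1 + p.2) = c at *
    generalize q.lam p.2 = b at *
    generalize q.mu p.2 = d at *
    have h1 := mul_neg_of_pos_of_neg hx hmy
    have h2 := mul_neg_of_neg_of_pos hmx hy
    have hlt : √(q.disc : ℝ) < |a * d + c * b| := by
      rw [abs_of_neg (by linarith)]; linarith
    refine ⟨hlt, ?_⟩
    rw [artanh_div_eq hs hlt, abs_of_neg (by linarith), hdet,
      show -(a * d + c * b) + (c * b - a * d) = (-2) * (a * d) by ring,
      show -(a * d + c * b) - (c * b - a * d) = (-2) * (c * b) by ring,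
      Real.log_mul (by norm_num) h1.ne, Real.log_mul (by norm_num) h2.ne,
      Real.log_mul hx.ne' hmy.ne, Real.log_mul hmx.ne hy.ne']
    ring

/-! ### Bank edges correspond to river pairs -/

/-- The set `{±v, ±w}`. -/
def edgeSet (p : (Fin 2 → ℤ) × (Fin 2 → ℤ)) : Set (Fin 2 → ℤ) := {p.1, -p.1, p.2, -p.2}

theorem mem_edgeSet {p : (Fin 2 → ℤ) × (Fin 2 → ℤ)} {x : Fin 2 → ℤ} :
    x ∈ edgeSet p ↔ x = p.1 ∨ x = -p.1 ∨ x = p.2 ∨ x = -p.2 := Iff.rfl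

theorem edgeSet_act (g : SL(2, ℤ)) (p : (Fin 2 → ℤ) × (Fin 2 → ℤ)) :
    edgeSet (act g p) = (fun v => g.1 *ᵥ v) '' edgeSet p := by
  simp only [edgeSet, act, Set.image_insert_eq, Set.image_singleton, Matrix.mulVec_neg]

theorem edgeSet_act_neg (g : SL(2, ℤ)) (p : (Fin 2 → ℤ) × (Fin 2 → ℤ)) :
    edgeSet (act (-g) p) = edgeSet (act g p) := by
  ext x
  simp only [mem_edgeSet, act, Matrix.SpecialLinearGroup.coe_neg, Matrix.neg_mulVec, neg_neg]
  tauto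

theorem bankPair_act {g : SL(2, ℤ)} (hg : g ∈ Topograph.periodGroup q)
    (p : (Fin 2 → ℤ) × (Fin 2 → ℤ)) : q.bankPair (act g p) = act g (q.bankPair p) := by
  have hg' : ∀ v : Fin 2 → ℤ, q.eval (g.1 *ᵥ v) = q.eval v := hg
  unfold bankPair act
  simp only [← Matrix.mulVec_add, hg']
  split_ifs <;> rfl

/-- Positivity of `lam` fixes the signs, and the orientation fixes the order. -/
theorem eq_of_edgeSet_eq {x y x' y' : Fin 2 → ℤ} (hx : 0 < q.lam x) (hy : 0 < q.lam y)
    (hx' : 0 < q.lam x') (hy' : 0 < q.lam y') (h : det x y = 1) (h' : det x' y' = 1)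
    (he : edgeSet (x, y) = edgeSet (x', y')) : x = x' ∧ y = y' := by
  have key : ∀ z, 0 < q.lam z → z ∈ edgeSet (x', y') → z = x' ∨ z = y' := by
    intro z hz hmem
    rcases mem_edgeSet.1 hmem with h | h | h | h
    · exact Or.inl h
    · rw [h, lam_neg] at hz; linarith
    · exact Or.inr h
    · rw [h, lam_neg] at hz; linarith
  have h1 := key x hx (he ▸ Or.inl rfl)
  have h2 := key y hy (he ▸ Or.inr (Or.inr (Or.inl rfl)))
  rcases h1 with rfl | rfl <;> rcases h2 with rfl | rfl
  · simp [det_self] at h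
  · exact ⟨rfl, rfl⟩
  · rw [det_swap] at h; omega
  · simp [det_self] at h

/-- The sign of `mu` tells on which bank the edge lies, hence which member of its basis is the sum;
subtraction recovers `p`. -/
theorem IsRiverPair.eq_of_edgeSet_eq (h : q.IsRiverPair p) (h' : q.IsRiverPair p')
    (hD : 0 < q.disc) (hsq : ¬ IsSquare q.disc)
    (he : edgeSet (q.bankPair p) = edgeSet (q.bankPair p')) : p = p' := by
  have hb : q.bankPair p = q.bankPair p' :=
    Prod.ext_iff.2 (BinaryForm.eq_of_edgeSet_eq h.lam_bankPair.1 h.lam_bankPair.2 h'.lam_bankPair.1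
      h'.lam_bankPair.2 h.det_bankPair h'.det_bankPair he)
  rcases h.mu_bankPair hD hsq with ⟨h1, -, h2⟩ | ⟨h1, -, h2⟩ <;>
    rcases h'.mu_bankPair hD hsq with ⟨h3, -, h4⟩ | ⟨h3, -, h4⟩
  · rw [h2, h4, Prod.mk.injEq] at hb
    obtain ⟨e1, e2⟩ := hb
    rw [e1] at e2
    exact Prod.ext e1 (add_left_cancel e2)
  · rw [hb] at h1; linarith
  · rw [hb] at h1; linarith
  · rw [h2, h4, Prod.mk.injEq] at hb
    obtain ⟨e1, e2⟩ := hb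
    rw [e2] at e1
    exact Prod.ext (add_right_cancel e1) e2

theorem eval_pos_of_pos (hD : 0 < q.disc) (hsq : ¬ IsSquare q.disc) {v : Fin 2 → ℤ}
    (h1 : 0 < q.lam v) (h2 : 0 < q.mu v) : 0 < q.eval v := by
  have : (0 : ℝ) < q.eval v := by rw [← lam_mul_mu hD hsq]; exact mul_pos h1 h2
  exact_mod_cast this

theorem eval_neg_of_neg (hD : 0 < q.disc) (hsq : ¬ IsSquare q.disc) {v : Fin 2 → ℤ}
    (h1 : 0 < q.lam v) (h2 : q.mu v < 0) : q.eval v < 0 := by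
  have : (q.eval v : ℝ) < 0 := by
    rw [← lam_mul_mu hD hsq]; exact mul_neg_of_pos_of_neg h1 h2
  exact_mod_cast this

theorem eval_of_mem_edgeSet {x : Fin 2 → ℤ} (hx : x ∈ edgeSet p) :
    q.eval x = q.eval p.1 ∨ q.eval x = q.eval p.2 := by
  rcases mem_edgeSet.1 hx with rfl | rfl | rfl | rfl <;> simp [eval_neg]

theorem isBasis_of_det_eq_one {v w : Fin 2 → ℤ} (h : det v w = 1) : Topograph.IsBasis v w := by
  have : v 0 * w 1 - v 1 * w 0 = 1 := h
  simp [Topograph.IsBasis, this]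

theorem IsRiverPair.exists_bankEdge (h : q.IsRiverPair p) (hD : 0 < q.disc)
    (hsq : ¬ IsSquare q.disc) :
    ∃ E : Topograph.BankEdge q, E.1.carrier = edgeSet (q.bankPair p) := by
  refine ⟨⟨⟨edgeSet (q.bankPair p), _, _, isBasis_of_det_eq_one h.det_bankPair, rfl⟩, ?_,
    ⟨{p.1, -p.1, p.2, -p.2, -(p.1 + p.2), - -(p.1 + p.2)}, p.1, p.2, -(p.1 + p.2), by simp,
      isBasis_of_det_eq_one h.det_eq, rfl⟩, ?_, ?_⟩, rfl⟩
  · rintro ⟨x, hx, y, hy, hqx, hqy⟩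
    obtain ⟨l1, l2⟩ := h.lam_bankPair
    have hx' := eval_of_mem_edgeSet (q := q) hx
    have hy' := eval_of_mem_edgeSet (q := q) hy
    rcases h.mu_bankPair hD hsq with ⟨m1, m2, -⟩ | ⟨m1, m2, -⟩
    · have k1 := eval_pos_of_pos hD hsq l1 m1
      have k2 := eval_pos_of_pos hD hsq l2 m2
      omega
    · have k1 := eval_neg_of_neg hD hsq l1 m1
      have k2 := eval_neg_of_neg hD hsq l2 m2
      omega
  · refine ⟨⟨edgeSet p, p.1, p.2, isBasis_of_det_eq_one h.det_eq, rfl⟩, ?_, ?_⟩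
    · exact ⟨p.2, Or.inr (Or.inr (Or.inl rfl)), p.1, Or.inl rfl,
        eval_neg_of_neg hD hsq h.lam_snd h.mu_snd, eval_pos_of_pos hD hsq h.lam_fst h.mu_fst⟩
    · intro x hx
      rcases mem_edgeSet.1 hx with rfl | rfl | rfl | rfl <;> simp
  · intro x hx
    rcases h.mu_bankPair hD hsq with ⟨-, -, hb⟩ | ⟨-, -, hb⟩ <;>
      simp only [hb] at hx <;>
      rcases mem_edgeSet.1 hx with rfl | rfl | rfl | rfl <;> simp

theorem edgeSet_swap (v w : Fin 2 → ℤ) : edgeSet (v, w) = edgeSet (w, v) := by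
  ext x; simp only [mem_edgeSet]; tauto

/-- A basis can be normalised to be positively oriented, with `lam` positive. -/
theorem exists_normalized_basis (hD : 0 < q.disc) (hsq : ¬ IsSquare q.disc) {v w : Fin 2 → ℤ}
    (h : Topograph.IsBasis v w) :
    ∃ x y, det x y = 1 ∧ 0 < q.lam x ∧ 0 < q.lam y ∧ edgeSet (x, y) = edgeSet (v, w) := by
  have h' : IsUnit (det v w) := h
  have hv : v ≠ 0 := by rintro rfl; simp [det] at h'
  have hw : w ≠ 0 := by rintro rfl; simp [det] at h'
  obtain ⟨x, hx, lx⟩ := exists_lam_pos hD hsq (eval_ne_zero hsq hv)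
  obtain ⟨y, hy, ly⟩ := exists_lam_pos hD hsq (eval_ne_zero hsq hw)
  have he : edgeSet (x, y) = edgeSet (v, w) := by
    ext z
    rcases hx with rfl | rfl <;> rcases hy with rfl | rfl <;>
      simp only [mem_edgeSet, neg_neg] <;> tauto
  have hu : IsUnit (det x y) := by
    rcases hx with rfl | rfl <;> rcases hy with rfl | rfl <;>
      simpa [det_neg_left, det_neg_right] using h'
  rcases Int.isUnit_iff.1 hu with h1 | h1
  · exact ⟨x, y, h1, lx, ly, he⟩
  · exact ⟨y, x, by rw [det_swap, h1, neg_neg], ly, lx, by rw [edgeSet_swap, he]⟩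

theorem abs_det_le_one_of_mem (V : Topograph.Vertex) {x y : Fin 2 → ℤ} (hx : x ∈ V.carrier)
    (hy : y ∈ V.carrier) : |det x y| ≤ 1 := by
  obtain ⟨v₁, v₂, v₃, h0, hb, hc⟩ := V.isSuperbase
  have h3 : v₃ = -(v₁ + v₂) := by rw [← add_eq_zero_iff_eq_neg', h0]
  have hu : det v₁ v₂ = 1 ∧ det v₂ v₁ = -1 ∨ det v₁ v₂ = -1 ∧ det v₂ v₁ = 1 := by
    rw [det_swap v₂ v₁, neg_inj, neg_eq_iff_eq_neg, and_self, and_self]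
    exact Int.isUnit_iff.1 hb
  rw [hc, h3] at hx hy
  simp only [Set.mem_insert_iff, Set.mem_singleton_iff] at hx hy
  rcases hx with rfl | rfl | rfl | rfl | rfl | rfl <;>
    rcases hy with rfl | rfl | rfl | rfl | rfl | rfl <;>
    rcases hu with ⟨h1, h2⟩ | ⟨h1, h2⟩ <;>
    simp [det_neg_left, det_neg_right, det_add_left, det_add_right, det_self, h1, h2]

theorem exists_opposite_sign {V : Topograph.Vertex}
    (hV : Topograph.IsRiverVertex q V) (x : Fin 2 → ℤ) (hx : q.eval x ≠ 0) :
    ∃ z ∈ V.carrier, q.eval x * q.eval z < 0 := by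
  obtain ⟨E, ⟨v, hv, w, hw, hqv, hqw⟩, hE⟩ := hV
  rcases lt_or_gt_of_ne hx with h | h
  · exact ⟨w, hE hw, mul_neg_of_neg_of_pos h hqw⟩
  · exact ⟨v, hE hv, mul_neg_of_pos_of_neg h hqv⟩

theorem exists_isRiverPair_of_bankEdge (hD : 0 < q.disc) (hsq : ¬ IsSquare q.disc)
    (E : Topograph.BankEdge q) :
    ∃ p, q.IsRiverPair p ∧ E.1.carrier = edgeSet (q.bankPair p) := by
  obtain ⟨E, hE, V, hV, hEV⟩ := E
  obtain ⟨v, w, hb, hc⟩ := E.isBasis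
  obtain ⟨x, y, hxy, lx, ly, he⟩ := exists_normalized_basis hD hsq hb
  replace hc : E.carrier = edgeSet (x, y) := hc.trans he.symm
  have hxE : x ∈ E.carrier := by rw [hc]; exact Or.inl rfl
  have hyE : y ∈ E.carrier := by rw [hc]; exact Or.inr (Or.inr (Or.inl rfl))
  have hx0 : q.eval x ≠ 0 := eval_ne_zero hsq (by rintro rfl; simp [lam] at lx)
  have hy0 : q.eval y ≠ 0 := eval_ne_zero hsq (by rintro rfl; simp [lam] at ly)
  -- A region `z` of the other sign at the river vertex has coordinates in `{-1, 0, 1}` in the basis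
  -- `x, y`.
  obtain ⟨z, hzV, hz⟩ := exists_opposite_sign hV x hx0
  have d1 := abs_le.1 (abs_det_le_one_of_mem V hzV (hEV hyE))
  have d2 := abs_le.1 (abs_det_le_one_of_mem V (hEV hxE) hzV)
  have hzxy := eq_det_smul_add hxy z
  have hdet := sqrt_disc_mul_det hsq x y
  rw [hxy, Int.cast_one, mul_one] at hdet
  have hs : 0 < √(q.disc : ℝ) := Real.sqrt_pos.2 (by exact_mod_cast hD)
  have hval : q.eval z = det z y ^ 2 * q.eval x + det z y * det x z * q.polar x y +
      det x z ^ 2 * q.eval y := by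
    conv_lhs => rw [hzxy]
    generalize det z y = i
    generalize det x z = j
    simp only [polar, eval, Pi.add_apply, Pi.smul_apply, smul_eq_mul]; ring
  have hmu : ∀ {v}, 0 < q.lam v → (0 < q.eval v → 0 < q.mu v) ∧ (q.eval v < 0 → q.mu v < 0) := by
    intro v hl
    constructor <;> intro hv
    · have : (0 : ℝ) < q.eval v := by exact_mod_cast hv
      rw [← lam_mul_mu hD hsq] at this
      exact (pos_iff_pos_of_mul_pos this).1 hl
    · by_contra hcon
      have : (q.eval v : ℝ) < 0 := by exact_mod_cast hv
      rw [← lam_mul_mu hD hsq] at this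
      exact absurd (mul_nonneg hl.le (not_lt.1 hcon)) (not_le.2 this)
  have hsub : q.eval (x - y) = q.eval x - q.polar x y + q.eval y := by
    simp only [polar, eval, Pi.add_apply, Pi.sub_apply]; ring
  have hpol := polar_eq_lam_mu hD hsq x y
  rcases lt_or_gt_of_ne hx0 with hx | hx
  · have hy : q.eval y < 0 := lt_of_le_of_ne
      (not_lt.1 fun hy => hE ⟨x, hxE, y, hyE, hx, hy⟩) hy0
    have mx := (hmu lx).2 hx
    have my := (hmu ly).2 hy
    have hz' : 0 < q.eval z := by
      by_contra hcon
      nlinarith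
    have hp0 : q.polar x y < 0 := by
      have : (q.polar x y : ℝ) < 0 := by rw [hpol]; nlinarith
      exact_mod_cast this
    -- `polar x y` has the sign of `q(x)` and `q(y)`, so `±x`, `±y` and `±(x + y)` are excluded: `z
    -- = ±(x - y)`.
    have hdiff : 0 < q.eval (x - y) := by
      rw [hsub]; rw [hval] at hz'
      generalize det z y = i at *
      generalize det x z = j at *
      obtain ⟨i1, i2⟩ := d1
      obtain ⟨j1, j2⟩ := d2
      interval_cases i <;> interval_cases j <;> omega
    have hr : (0 : ℝ) < q.eval (x - y) := by exact_mod_cast hdiff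
    rw [← lam_mul_mu hD hsq] at hr
    have e1 : q.lam x = q.lam (x - y) + q.lam y := by rw [← lam_add, sub_add_cancel]
    have e2 : q.mu x = q.mu (x - y) + q.mu y := by rw [← mu_add, sub_add_cancel]
    -- Otherwise `lam` and `mu` are both nonpositive at `x - y`, and `√D = mu (x - y) * lam y - lam
    -- (x - y) * mu y` would be at most zero.
    have lxy : 0 < q.lam (x - y) := by
      by_contra hcon
      have : ¬ 0 < q.mu (x - y) := fun h => hcon ((pos_iff_pos_of_mul_pos hr).2 h)
      rw [e1, e2] at hdet
      nlinarith
    have hriver : q.IsRiverPair (x - y, y) := ⟨by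
      rw [show x - y = x + -y by abel, det_add_left, det_neg_left, det_self, hxy]; rfl,
      lxy, ly, (hmu lxy).1 hdiff, my⟩
    refine ⟨_, hriver, ?_⟩
    rw [bankPair, if_neg (by simp only [sub_add_cancel]; omega)]
    simp only [sub_add_cancel]
    exact hc
  · have hy : 0 < q.eval y := lt_of_le_of_ne
      (not_lt.1 fun hy => hE ⟨y, hyE, x, hxE, hy, hx⟩) hy0.symm
    have mx := (hmu lx).1 hx
    have my := (hmu ly).1 hy
    have hz' : q.eval z < 0 := by
      by_contra hcon
      nlinarith
    have hp0 : 0 < q.polar x y := by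
      have : (0 : ℝ) < q.polar x y := by rw [hpol]; positivity
      exact_mod_cast this
    have hdiff : q.eval (x - y) < 0 := by
      rw [hsub]; rw [hval] at hz'
      generalize det z y = i at *
      generalize det x z = j at *
      obtain ⟨i1, i2⟩ := d1
      obtain ⟨j1, j2⟩ := d2
      interval_cases i <;> interval_cases j <;> omega
    have hdiff' : q.eval (y - x) < 0 := by rwa [← eval_neg, neg_sub]
    have hr : (q.eval (y - x) : ℝ) < 0 := by exact_mod_cast hdiff'
    rw [← lam_mul_mu hD hsq] at hr
    have e1 : q.lam y = q.lam x + q.lam (y - x) := by rw [← lam_add, add_sub_cancel]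
    have e2 : q.mu y = q.mu x + q.mu (y - x) := by rw [← mu_add, add_sub_cancel]
    have lxy : 0 < q.lam (y - x) := by
      by_contra hcon
      have : 0 < q.mu (y - x) := by
        by_contra h
        nlinarith
      rw [e1, e2] at hdet
      nlinarith
    have hriver : q.IsRiverPair (x, y - x) := ⟨by
      rw [show y - x = y + -x by abel, det_add_right, det_neg_right, det_self, hxy]; rfl,
      lx, lxy, mx, (hmu lxy).2 hdiff'⟩
    refine ⟨_, hriver, ?_⟩
    rw [bankPair, if_pos (by simpa only [add_sub_cancel] using hy)]
    simp only [add_sub_cancel]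
    exact hc

end BinaryForm

/-! ### Summation over one period -/

theorem corollary1p8 (q : BinaryForm) (hq : q.IsPrimitive) (D : ℤ) (hdisc : q.disc = D)
    (hD : 0 < D) (hsq : ¬ IsSquare D) :
    Finite (Topograph.BankEdgeModPeriod q) ∧
    (∀ x : Topograph.BankEdgeModPeriod q,
      √(D : ℝ) < (Topograph.absLabelModPeriod q x : ℝ)) ∧
    2 * Real.log (FundamentalUnit.epsilon D) =
      ∑ᶠ x : Topograph.BankEdgeModPeriod q,
        Real.artanh (√(D : ℝ) / (Topograph.absLabelModPeriod q x : ℝ)) := by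
  open BinaryForm in
  subst hdisc
  obtain ⟨p, hp⟩ := exists_isRiverPair hD hsq
  obtain ⟨n, hn0, ⟨g, hg, hgε, hn⟩, hmin⟩ := hp.exists_period hq hD hsq
  have hriver := hp.iterate_step hD hsq
  choose E hE using fun i => (hriver i).exists_bankEdge hD hsq
  have hlabel : ∀ i, Topograph.absLabelModPeriod q (Quotient.mk _ (E i)) =
      |q.polar (q.bankPair (q.step^[i] p)).1 (q.bankPair (q.step^[i] p)).2| :=
    fun i => Topograph.absLabel_eq q (E i).1 (hE i)
  have hdistinct : ∀ i j, i < j → j < n → ∀ h ∈ Topograph.periodGroup q,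
      q.step^[j] p ≠ act h (q.step^[i] p) := by
    intro i j hij hjn h hh heq
    -- Walking `n - j` further steps would bring the river back after `n - j + i < n` steps.
    have h1 : q.step^[n - j + i] p = act (h⁻¹ * g) p := by
      have h2 := congrArg (q.step^[n - j]) heq
      rw [← Function.iterate_add_apply, Nat.sub_add_cancel hjn.le, hn, step_iterate_act hh,
        ← Function.iterate_add_apply] at h2
      rw [act_mul, h2, ← act_mul, inv_mul_cancel, act_one]
    have := hmin (n - j + i) (by omega) ⟨_, mul_mem (inv_mem hh) hg, h1⟩
    omega
  have hbij : Function.Bijective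
      (fun i : Fin n => (Quotient.mk _ (E i) : Topograph.BankEdgeModPeriod q)) := by
    constructor
    · intro i j hij
      obtain ⟨h, hh, hE'⟩ : ∃ h ∈ Topograph.periodGroup q,
          (E j).1.carrier = (fun v => h.1 *ᵥ v) '' (E i).1.carrier := Quotient.exact hij
      rw [hE, hE, ← edgeSet_act] at hE'
      obtain ⟨k, hk, hk'⟩ : ∃ k ∈ Topograph.periodGroup q,
          q.step^[j] p = act k (q.step^[i] p) := by
        obtain ⟨η, hη0, hη, -⟩ := exists_hasMultiplier hq hD hsq hh
        -- An element with negative multiplier does not preserve river pairs, but its negative does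
        -- and moves the edges in the same way.
        rcases lt_or_gt_of_ne hη0 with hlt | hgt
        · refine ⟨-h, neg_mem_periodGroup hh, (hriver j).eq_of_edgeSet_eq
            (hη.neg.isRiverPair_act (neg_pos.2 hlt) (hriver i)) hD hsq ?_⟩
          rw [bankPair_act (neg_mem_periodGroup hh), edgeSet_act_neg, hE']
        · refine ⟨h, hh, (hriver j).eq_of_edgeSet_eq
            (hη.isRiverPair_act hgt (hriver i)) hD hsq ?_⟩
          rw [bankPair_act hh, hE']
      rcases lt_trichotomy i.1 j.1 with hlt | heq | hgt
      · exact absurd hk' (hdistinct i j hlt j.2 k hk)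
      · exact Fin.ext heq
      · refine absurd ?_ (hdistinct j i hgt i.2 k⁻¹ (inv_mem hk))
        rw [hk', ← act_mul, inv_mul_cancel, act_one]
    · intro x
      induction x using Quotient.inductionOn with
      | h F =>
        obtain ⟨p', hp', hF⟩ := exists_isRiverPair_of_bankEdge hD hsq F
        obtain ⟨i, hi, k, hk, hk'⟩ := hp.exists_eq_act_iterate hp' hD hsq hn0 hg hgε hn
        refine ⟨⟨i, hi⟩, Quotient.sound ⟨k, hk, ?_⟩⟩
        rw [hF, hE, hk', bankPair_act hk, edgeSet_act]
  refine ⟨Finite.of_surjective _ hbij.2, fun x => ?_, ?_⟩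
  · obtain ⟨i, rfl⟩ := hbij.2 x
    rw [hlabel]
    exact ((hriver i).sqrt_lt_and_artanh_eq hD hsq).1
  -- The sum telescopes to half of `potential (act g p) - potential p`, which is half of `4 log
  -- ε_D`.
  · rw [← finsum_eq_of_bijective _ hbij (f := fun i : Fin n =>
      (q.potential (q.step^[i + 1] p) - q.potential (q.step^[i] p)) / 2), finsum_eq_sum_of_fintype,
      Fin.sum_univ_eq_sum_range (fun i : ℕ =>
        (q.potential (q.step^[i + 1] p) - q.potential (q.step^[i] p)) / 2), ← Finset.sum_div,
      Finset.sum_range_sub (fun i => q.potential (q.step^[i] p)), hn,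
      hp.potential_act (zero_lt_one.trans (one_lt_epsilon hD hsq)) hgε,
      Function.iterate_zero_apply]
    · ring
    · intro i
      rw [hlabel, ((hriver i).sqrt_lt_and_artanh_eq hD hsq).2, Function.iterate_succ_apply']
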